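/- Let $H_a\otimes H_b$ be a finite-dimensional bipartite quantum system, let $\Pi^1,\Pi^2$ be orthogonal projectors on $H_a$ with $\Pi^1+\Pi^2=\mathbb 1$, and let $x\in\mathbb R$. Put $\tau_1=\sqrt{\tfrac{1-\tanh x}{2}}$, $\tau_2=\sqrt{\tfrac{1+\tanh x}{2}}$, let $$\Omega_x=\tau_1\Pi^1+\tau_2\Pi^2,\qquad \Omega_{-x}=\tau_2\Pi^1+\tau_1\Pi^2$$ be the weak measurement operators of strength $x$, and let $\Omega(A)=\sum_{k=\pm x}(\Omega_k\otimes\mathbb 1)\,A\,(\Omega_k\otimes\mathbb 1)$. For a state (density operator) $\rho$ on $H_a\otimes H_b$ define the coherence of $\rho$ relative to the weak measurement by $$C_H(\rho|\Omega)=\big\|\sqrt\rho-\Omega(\sqrt\rho)\big\|^2,\qquad \|A\|=\sqrt{\operatorname{tr}(A^\dagger A)},$$ the affinity by $d(\rho|\Omega)=\operatorname{tr}\big(\sqrt\rho\,\Omega(\sqrt\rho)\big)$, and the Wigner–Yanase skew information of $\rho$ with respect to a Hermitian operator $K$ by $I(\rho,K)=-\tfrac12\operatorname{tr}\big([\sqrt\rho,K]^2\big)$.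 Then for every finite family of states $\rho_i$ on $H_a\otimes H_b$ and all $p_i\ge 0$ with $\sum_i p_i=1$: 1. $C_H\big(\sum_i p_i\rho_i\,\big|\,\Omega\big)\le\sum_i p_i\,C_H(\rho_i|\Omega)$; 2. $\sum_{k=\pm x}I\big(\sum_i p_i\rho_i,\Omega_k\otimes\mathbb 1\big)\le\sum_i p_i\sum_{k=\pm x}I(\rho_i,\Omega_k\otimes\mathbb 1)$; 3. $d\big(\sum_i p_i\rho_i\,\big|\,\Omega\big)\ge\sum_i p_i\,d(\rho_i|\Omega)$, that is, $1-d(\cdot|\Omega)$ is convex. -/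

import Mathlib

open scoped Kronecker MatrixOrder ComplexOrder

noncomputable section

/-- A quantum state (density matrix): positive semidefinite with unit trace. -/
def IsDensityMatrix {d : Type*} [Fintype d] (ρ : Matrix d d ℂ) : Prop :=
  ρ.PosSemidef ∧ ρ.trace = 1

/-- The Hilbert–Schmidt norm `√(tr (A† A))`; the trace is real and nonnegative. -/
def hsNorm {d : Type*} [Fintype d] (A : Matrix d d ℂ) : ℝ :=
  Real.sqrt (A.conjTranspose * A).trace.re

/-- The weak measurement operator `Ω_x = τ₁ Π¹ + τ₂ Π²` of strength `x`, where
`τ₁ = √((1 - tanh x) / 2)` and `τ₂ = √((1 + tanh x) / 2)`. -/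
def weakOp {m : Type*} (P Q : Matrix m m ℂ) (x : ℝ) : Matrix m m ℂ :=
  Real.sqrt ((1 - Real.tanh x) / 2) • P + Real.sqrt ((1 + Real.tanh x) / 2) • Q

/-- The second operator `Ω_{-x}` is `τ₂ Π¹ + τ₁ Π²`. -/
theorem weakOp_neg {m : Type*} (P Q : Matrix m m ℂ) (x : ℝ) :
    weakOp P Q (-x) =
      Real.sqrt ((1 + Real.tanh x) / 2) • P + Real.sqrt ((1 - Real.tanh x) / 2) • Q := by
  simp [weakOp, Real.tanh_neg, sub_eq_add_neg]

variable {m n : Type*} [Fintype m] [DecidableEq m] [Fintype n] [DecidableEq n]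

/-- The weak measurement of the first subsystem of a bipartite system,
`Ω(A) = ∑_{k = ± x} (Ω_k ⊗ 1) A (Ω_k ⊗ 1)`. -/
def weakMeas (P Q : Matrix m m ℂ) (x : ℝ) (A : Matrix (m × n) (m × n) ℂ) :
    Matrix (m × n) (m × n) ℂ :=
  (weakOp P Q x ⊗ₖ (1 : Matrix n n ℂ)) * A * (weakOp P Q x ⊗ₖ (1 : Matrix n n ℂ)) +
    (weakOp P Q (-x) ⊗ₖ (1 : Matrix n n ℂ)) * A * (weakOp P Q (-x) ⊗ₖ (1 : Matrix n n ℂ))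

/-- Coherence relative to the weak measurement, `C_H(ρ|Ω) = ‖√ρ - Ω(√ρ)‖²`. -/
def weakCoherence (P Q : Matrix m m ℂ) (x : ℝ) (ρ : Matrix (m × n) (m × n) ℂ) : ℝ :=
  hsNorm (CFC.sqrt ρ - weakMeas P Q x (CFC.sqrt ρ)) ^ 2

/-- The affinity `d(ρ|Ω) = tr (√ρ Ω(√ρ))`, which is real for states `ρ`. -/
def weakAffinity (P Q : Matrix m m ℂ) (x : ℝ) (ρ : Matrix (m × n) (m × n) ℂ) : ℝ :=
  (CFC.sqrt ρ * weakMeas P Q x (CFC.sqrt ρ)).trace.re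

/-- The Wigner–Yanase skew information `I(ρ, K) = -(1/2) tr ([√ρ, K]²)`, which is real for
positive semidefinite `ρ` and Hermitian `K`. -/
def skewInfo {d : Type*} [Fintype d] [DecidableEq d] (ρ K : Matrix d d ℂ) : ℝ :=
  -(1 / 2) * ((CFC.sqrt ρ * K - K * CFC.sqrt ρ) ^ 2).trace.re

/-- The total skew information of the weak measurement, `∑_{k = ± x} I(ρ, Ω_k ⊗ 1)`. -/
def weakSkewInfo (P Q : Matrix m m ℂ) (x : ℝ) (ρ : Matrix (m × n) (m × n) ℂ) : ℝ :=
  skewInfo ρ (weakOp P Q x ⊗ₖ (1 : Matrix n n ℂ)) +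
    skewInfo ρ (weakOp P Q (-x) ⊗ₖ (1 : Matrix n n ℂ))

end

/-! ### Trace inequalities leading to Wigner–Yanase concavity. -/

namespace Matrix

variable {d ι : Type*} [Fintype d]

/-! All three claims reduce to concavity of `ρ ↦ tr (√ρ K √ρ K)` for Hermitian `K`: the affinity is
a sum of two such terms, while the skew information and the coherence are, up to a nonnegative
factor, a term linear in `ρ` minus such terms.

For concavity put `T = √(∑ pᵢ ρᵢ)` and `Sᵢ = √pᵢ √ρᵢ`, so that `∑ Sᵢ² = T²`. It must be shown that
the form of `K ↦ ∑ Sᵢ K Sᵢ` is dominated by that of `K ↦ T K T`. For invertible `T` this is a bound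
by `1` on generalized eigenvalues (`PosDef.generalized_eigenvalue_le_one`), which follows from
Cauchy–Schwarz. The singular case is a limit. -/

theorem re_trace_conjTranspose_mul_self_nonneg (A : Matrix d d ℂ) : 0 ≤ (Aᴴ * A).trace.re :=
  (Complex.nonneg_iff.1 (posSemidef_conjTranspose_mul_self A).trace_nonneg).1

/-- Cauchy–Schwarz for the Hilbert–Schmidt inner product, in arithmetic-mean form. -/
theorem two_mul_re_trace_conjTranspose_mul_le (A B : Matrix d d ℂ) :
    2 * (Aᴴ * B).trace.re ≤ (Aᴴ * A).trace.re + (Bᴴ * B).trace.re := by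
  have h := re_trace_conjTranspose_mul_self_nonneg (A - B)
  have hs : (Bᴴ * A).trace.re = (Aᴴ * B).trace.re := by
    have := trace_conjTranspose (Aᴴ * B)
    rw [conjTranspose_mul, conjTranspose_conjTranspose] at this
    rw [this]; simp
  simp only [conjTranspose_sub, mul_sub, sub_mul, trace_sub, Complex.sub_re] at h
  linarith

theorem PosSemidef.sum_re_trace_le {s : Finset ι} {S : ι → Matrix d d ℂ} {C : Matrix d d ℂ}
    (h : (C - ∑ i ∈ s, S i).PosSemidef) (v : Matrix d d ℂ) :
    ∑ i ∈ s, (vᴴ * S i * v).trace.re ≤ (vᴴ * C * v).trace.re := by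
  have := (Complex.nonneg_iff.1 (h.conjTranspose_mul_mul_same v).trace_nonneg).1
  simpa [mul_sub, sub_mul, Finset.mul_sum, Finset.sum_mul, trace_sum] using this

variable [DecidableEq d]

/-- If `∑ Sᵢ² ≤ T²`, then the generalized eigenvalues of `K ↦ ∑ Sᵢ K Sᵢ` with respect to
`K ↦ T K T` are at most `1`. -/
theorem PosDef.generalized_eigenvalue_le_one {T : Matrix d d ℂ} (hT : T.PosDef) {s : Finset ι}
    {S : ι → Matrix d d ℂ} (hS : ∀ i ∈ s, (S i).IsHermitian)
    (h : (T * T - ∑ i ∈ s, S i * S i).PosSemidef) {K : Matrix d d ℂ} (hK : K ≠ 0) {c : ℝ}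
    (heq : ∑ i ∈ s, S i * K * S i = c • (T * K * T)) : c ≤ 1 := by
  have hu : IsUnit T.det := (isUnit_iff_isUnit_det T).1 hT.isUnit
  have hTh : Tᴴ = T := hT.1
  -- Pairing the eigenvalue equation with `v = T⁻¹ K T` gives `c * a`, where `a = ‖K T‖²`.
  -- Cauchy–Schwarz bounds it by the mean of `tr (v† T² v)` and `tr (K T² K†)`, and both equal `a`.
  obtain ⟨v, hTv⟩ : ∃ v, T * v = K * T :=
    ⟨T⁻¹ * (K * T), mul_nonsing_inv_cancel_left _ _ hu⟩
  have hvT : vᴴ * T = T * Kᴴ := by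
    simpa [conjTranspose_mul, hTh] using congrArg (fun X => Xᴴ) hTv
  set a := ((K * T)ᴴ * (K * T)).trace.re with ha
  have hapos : 0 < a := by
    refine lt_of_le_of_ne (re_trace_conjTranspose_mul_self_nonneg _) fun h0 => hK ?_
    have h1 : ((K * T)ᴴ * (K * T)).trace = 0 := by
      refine Complex.ext h0.symm ?_
      exact (Complex.nonneg_iff.1 (posSemidef_conjTranspose_mul_self (K * T)).trace_nonneg).2.symm
    have h2 := trace_conjTranspose_mul_self_eq_zero_iff.1 h1
    simpa [mul_nonsing_inv_cancel_right _ _ hu] using congrArg (· * T⁻¹) h2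
  have e1 : (vᴴ * (T * T) * v).trace.re = a := by
    rw [ha, conjTranspose_mul, hTh, ← hvT, ← hTv]; simp only [mul_assoc]
  have e2 : (Kᴴᴴ * (T * T) * Kᴴ).trace.re = a := by
    rw [ha, conjTranspose_conjTranspose, conjTranspose_mul, hTh, trace_mul_comm (T * Kᴴ)]
    simp only [mul_assoc]
  have e3 : ∑ i ∈ s, (vᴴ * (S i * K * S i)).trace.re = c * a := by
    rw [← Complex.re_sum, ← trace_sum, ← Finset.mul_sum, heq, mul_smul_comm, trace_smul, Complex.smul_re,
      smul_eq_mul, ha, conjTranspose_mul, hTh, ← hvT]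
    simp only [mul_assoc]
  have b1 := h.sum_re_trace_le v
  have b2 := h.sum_re_trace_le Kᴴ
  have key : ∑ i ∈ s, 2 * (vᴴ * (S i * K * S i)).trace.re ≤
      ∑ i ∈ s, ((vᴴ * (S i * S i) * v).trace.re + (Kᴴᴴ * (S i * S i) * Kᴴ).trace.re) := by
    refine Finset.sum_le_sum fun i hi => ?_
    have hSi : (S i)ᴴ = S i := hS i hi
    have := two_mul_re_trace_conjTranspose_mul_le (S i * v) (K * S i)
    rw [conjTranspose_mul, conjTranspose_mul, hSi, trace_mul_comm (S i * Kᴴ)] at this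
    simpa only [conjTranspose_conjTranspose, mul_assoc] using this
  rw [← Finset.mul_sum, e3, Finset.sum_add_distrib] at key
  rw [e1] at b1
  rw [e2] at b2
  nlinarith

/-- If `∑ Sᵢ² ≤ T²` with `T` positive definite, then `∑ tr (K† Sᵢ K Sᵢ) ≤ tr (K† T K T)`. -/
theorem PosDef.sum_re_trace_le {T : Matrix d d ℂ} (hT : T.PosDef) {s : Finset ι}
    {S : ι → Matrix d d ℂ} (hS : ∀ i ∈ s, (S i).IsHermitian)
    (h : (T * T - ∑ i ∈ s, S i * S i).PosSemidef) (K : Matrix d d ℂ) :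
    ∑ i ∈ s, (Kᴴ * S i * K * S i).trace.re ≤ (Kᴴ * T * K * T).trace.re := by
  set R := CFC.sqrt T with hR
  have hRR : R * R = T := CFC.sqrt_mul_sqrt_self T hT.posSemidef.nonneg
  have hRh : Rᴴ = R := (nonneg_iff_posSemidef.1 (CFC.sqrt_nonneg T)).1
  have hu : IsUnit R.det := by
    have : IsUnit (R * R).det := hRR ▸ (isUnit_iff_isUnit_det T).1 hT.isUnit
    rw [det_mul] at this
    exact isUnit_of_mul_isUnit_left this
  have hUh : (R⁻¹)ᴴ = R⁻¹ := by rw [conjTranspose_nonsing_inv, hRh]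
  set Z : ι → Matrix d d ℂ := fun i => R⁻¹ * S i * R⁻¹ with hZ
  have hZh : ∀ i ∈ s, (Z i)ᴴ = Z i := fun i hi => by
    have hSi : (S i)ᴴ = S i := hS i hi
    simp only [hZ, conjTranspose_mul, hUh, hSi, mul_assoc]
  -- Conjugating by `R = √T` turns the generalized eigenvalue problem into an ordinary Hermitian
  -- one: `H` is the matrix of `W ↦ W - ∑ Zᵢ W Zᵢ` on vectorized matrices.
  set H : Matrix (d × d) (d × d) ℂ := 1 - ∑ i ∈ s, (Z i)ᵀ ⊗ₖ Z i with hH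
  have hHv : ∀ W : Matrix d d ℂ, H *ᵥ vec W = vec (W - ∑ i ∈ s, Z i * W * Z i) := fun W => by
    simp only [hH, sub_mulVec, one_mulVec, sum_mulVec, kronecker_mulVec_vec, transpose_transpose,
      vec_sub, vec_sum]
  have hHh : H.IsHermitian := by
    rw [IsHermitian, hH, conjTranspose_sub, conjTranspose_one, conjTranspose_sum]
    congr 1
    refine Finset.sum_congr rfl fun i hi => ?_
    have hZt : ((Z i)ᵀ)ᴴ = (Z i)ᵀ := congrArg (fun X => Xᵀ) (hZh i hi)
    rw [conjTranspose_kronecker, hZh i hi, hZt]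
  have hHp : H.PosSemidef := by
    rw [hHh.posSemidef_iff_eigenvalues_nonneg]
    intro j
    obtain ⟨W, hW⟩ := (vec_bijective (R := ℂ) (m := d) (n := d)).2 (hHh.eigenvectorBasis j)
    have hW0 : W ≠ 0 := by
      rintro rfl
      refine hHh.eigenvectorBasis.orthonormal.ne_zero j ?_
      ext x
      rw [← hW]; rfl
    have hev := hHh.mulVec_eigenvectorBasis j
    rw [← hW, hHv, ← vec_smul, vec_inj] at hev
    have hsum : ∑ i ∈ s, Z i * W * Z i = (1 - hHh.eigenvalues j) • W := by
      rw [sub_smul, one_smul, ← hev, sub_sub_cancel]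
    have hK0 : R⁻¹ * W * R⁻¹ ≠ 0 := fun h0 => hW0 <| by
      have := congrArg (fun X => R * X * R) h0
      simpa [mul_assoc, mul_nonsing_inv_cancel_left _ _ hu, nonsing_inv_mul _ hu] using this
    have := hT.generalized_eigenvalue_le_one hS h hK0 (c := 1 - hHh.eigenvalues j) <| by
      have e := congrArg (fun X => R * X * R) hsum
      simp only [Finset.mul_sum, Finset.sum_mul, hZ, mul_smul_comm, smul_mul_assoc] at e
      convert e using 2
      · simp [mul_assoc, mul_nonsing_inv_cancel_left _ _ hu, nonsing_inv_mul _ hu]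
      · rw [← hRR]
        simp [mul_assoc, mul_nonsing_inv_cancel_left _ _ hu, nonsing_inv_mul_cancel_left _ _ hu]
    simpa using this
  -- Evaluating the form of `H` at `R K R` cancels every `R⁻¹`.
  have hfin := hHp.re_dotProduct_nonneg (vec (R * K * R))
  rw [hHv, star_vec_dotProduct_vec] at hfin
  have e1 : ((R * K * R)ᴴ * (R * K * R)).trace = (Kᴴ * T * K * T).trace := by
    rw [conjTranspose_mul, conjTranspose_mul, hRh, ← hRR, mul_assoc R, trace_mul_comm]
    simp only [mul_assoc]
  have e2 : ∀ i, ((R * K * R)ᴴ * (Z i * (R * K * R) * Z i)).trace =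
      (Kᴴ * S i * K * S i).trace := fun i => by
    rw [conjTranspose_mul, conjTranspose_mul, hRh, hZ, mul_assoc R, trace_mul_comm]
    simp only [mul_assoc, mul_nonsing_inv_cancel_left _ _ hu, nonsing_inv_mul_cancel_left _ _ hu,
      nonsing_inv_mul _ hu, mul_one]
  simp only [mul_sub, Finset.mul_sum, trace_sub, trace_sum, e1, e2] at hfin
  simpa using hfin

/-- **Wigner–Yanase concavity**: `A ↦ tr (√A K √A K)` is concave on positive semidefinite `A`. -/
theorem sum_re_trace_sqrt_le [Fintype ι] {p : ι → ℝ} (hp : ∀ i, 0 ≤ p i)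
    {ρ : ι → Matrix d d ℂ} (hρ : ∀ i, (ρ i).PosSemidef) {K : Matrix d d ℂ} (hK : K.IsHermitian) :
    ∑ i, p i * (CFC.sqrt (ρ i) * K * CFC.sqrt (ρ i) * K).trace.re ≤
      (CFC.sqrt (∑ i, p i • ρ i) * K * CFC.sqrt (∑ i, p i • ρ i) * K).trace.re := by
  have hK' : Kᴴ = K := hK
  have hsum : (∑ i, p i • ρ i).PosSemidef :=
    posSemidef_sum _ fun i _ => (hρ i).smul (hp i)
  set T := CFC.sqrt (∑ i, p i • ρ i) with hTdef
  have hTT : T * T = ∑ i, p i • ρ i := CFC.sqrt_mul_sqrt_self _ hsum.nonneg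
  have hT : T.PosSemidef := nonneg_iff_posSemidef.1 (CFC.sqrt_nonneg _)
  have hmain : ∀ ε : ℝ, 0 < ε → ∑ i, p i * (CFC.sqrt (ρ i) * K * CFC.sqrt (ρ i) * K).trace.re ≤
      (T * K * T * K).trace.re + ε * (2 * (T * K * K).trace.re) + ε ^ 2 * (K * K).trace.re := by
    intro ε hε
    -- `T` may be singular. The shift preserves the hypothesis, since `(T + ε)² - T² = 2εT + ε² ≥
    -- 0`.
    have hTε : (T + ε • (1 : Matrix d d ℂ)).PosDef :=
      PosDef.posSemidef_add hT (PosDef.one.smul hε)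
    have := hTε.sum_re_trace_le (s := Finset.univ)
      (S := fun i => Real.sqrt (p i) • CFC.sqrt (ρ i)) (fun i _ => ?_) ?_ K
    · convert this using 1
      · refine Finset.sum_congr rfl fun i _ => ?_
        rw [hK', trace_mul_comm]
        simp only [mul_smul_comm, smul_mul_assoc, trace_smul, smul_smul,
          Real.mul_self_sqrt (hp i), Complex.smul_re, smul_eq_mul, mul_assoc]
      · have e : (K * (K * T)).trace = (T * (K * K)).trace := by
          rw [← mul_assoc, trace_mul_comm]
        have e' : (K * (T * K)).trace = (T * (K * K)).trace := by
          rw [trace_mul_comm, mul_assoc]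
        have e'' : (K * (T * (K * T))).trace = (T * (K * (T * K))).trace := by
          rw [trace_mul_comm]; simp only [mul_assoc]
        simp only [hK', mul_add, add_mul, mul_smul_comm, smul_mul_assoc, mul_one, trace_add,
          trace_smul, mul_assoc, Complex.add_re, Complex.smul_re, smul_eq_mul, e, e', e'']
        ring
    · exact ((nonneg_iff_posSemidef.1 (CFC.sqrt_nonneg (ρ i))).smul (Real.sqrt_nonneg _)).1
    · have : (T + ε • (1 : Matrix d d ℂ)) * (T + ε • 1) -
          ∑ i, (Real.sqrt (p i) • CFC.sqrt (ρ i)) * (Real.sqrt (p i) • CFC.sqrt (ρ i)) =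
          (2 * ε) • T + (ε * ε) • (1 : Matrix d d ℂ) := by
        have : ∀ i, (Real.sqrt (p i) • CFC.sqrt (ρ i)) * (Real.sqrt (p i) • CFC.sqrt (ρ i)) =
            p i • ρ i := fun i => by
          rw [smul_mul_smul_comm, Real.mul_self_sqrt (hp i),
            CFC.sqrt_mul_sqrt_self _ (hρ i).nonneg]
        simp only [this, ← hTT, add_mul, mul_add, smul_mul_assoc, mul_smul_comm, mul_one, one_mul]
        module
      rw [this]
      exact (hT.smul (by positivity)).add (PosSemidef.one.smul (by positivity))
  have hlim : Filter.Tendsto (fun ε : ℝ => (T * K * T * K).trace.re +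
      ε * (2 * (T * K * K).trace.re) + ε ^ 2 * (K * K).trace.re) (nhdsWithin 0 (Set.Ioi 0))
      (nhds ((T * K * T * K).trace.re)) := by
    have : Continuous (fun ε : ℝ => (T * K * T * K).trace.re +
      ε * (2 * (T * K * K).trace.re) + ε ^ 2 * (K * K).trace.re) := by fun_prop
    simpa using (this.tendsto 0).mono_left nhdsWithin_le_nhds
  exact ge_of_tendsto hlim (Filter.eventually_of_mem self_mem_nhdsWithin hmain)

end Matrix

/-! ### Reduction of the weak-measurement quantities to concavity. -/

theorem weakOp_isHermitian {m : Type*} {P Q : Matrix m m ℂ} (hP : P.IsHermitian) (hQ : Q.IsHermitian)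
    (x : ℝ) : (weakOp P Q x).IsHermitian := by
  have hP' : P.conjTranspose = P := hP
  have hQ' : Q.conjTranspose = Q := hQ
  simp [Matrix.IsHermitian, weakOp, Matrix.conjTranspose_smul, hP', hQ']

theorem kronecker_one_isHermitian {m n : Type*} [DecidableEq n] {A : Matrix m m ℂ}
    (hA : A.IsHermitian) :
    (A ⊗ₖ (1 : Matrix n n ℂ)).IsHermitian := by
  have hA' : A.conjTranspose = A := hA
  rw [Matrix.IsHermitian, Matrix.conjTranspose_kronecker, hA', Matrix.conjTranspose_one]

theorem hsNorm_sq {d : Type*} [Fintype d] (A : Matrix d d ℂ) : hsNorm A ^ 2 = (A.conjTranspose * A).trace.re :=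
  Real.sq_sqrt (Matrix.re_trace_conjTranspose_mul_self_nonneg A)

section WeakMeasurement

variable {m n d ι : Type*} [Fintype m] [DecidableEq m] [Fintype n] [DecidableEq n]
  [Fintype d] [DecidableEq d]

theorem weakAffinity_eq (P Q : Matrix m m ℂ) (x : ℝ) (ρ : Matrix (m × n) (m × n) ℂ) :
    weakAffinity P Q x ρ =
      (CFC.sqrt ρ * (weakOp P Q x ⊗ₖ 1) * CFC.sqrt ρ * (weakOp P Q x ⊗ₖ 1)).trace.re +
      (CFC.sqrt ρ * (weakOp P Q (-x) ⊗ₖ 1) * CFC.sqrt ρ * (weakOp P Q (-x) ⊗ₖ 1)).trace.re := by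
  simp only [weakAffinity, weakMeas, mul_add, Matrix.trace_add, Complex.add_re, mul_assoc]

theorem skewInfo_eq {ρ : Matrix d d ℂ} (hρ : ρ.PosSemidef) (K : Matrix d d ℂ) :
    skewInfo ρ K =
      (ρ * (K * K)).trace.re - (CFC.sqrt ρ * K * CFC.sqrt ρ * K).trace.re := by
  have hS : CFC.sqrt ρ * CFC.sqrt ρ = ρ := CFC.sqrt_mul_sqrt_self _ hρ.nonneg
  rw [skewInfo]
  generalize CFC.sqrt ρ = S at *
  have e1 : (S * (K * (K * S))).trace = (S * (S * (K * K))).trace := by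
    rw [← mul_assoc K, ← mul_assoc, Matrix.trace_mul_comm]
  have e2 : (K * (S * (S * K))).trace = (S * (S * (K * K))).trace := by
    rw [Matrix.trace_mul_comm]; simp only [mul_assoc]
  have e3 : (K * (S * (K * S))).trace = (S * (K * (S * K))).trace := by
    rw [Matrix.trace_mul_comm]; simp only [mul_assoc]
  simp only [← hS, sq, sub_mul, mul_sub, Matrix.trace_sub, Complex.sub_re, mul_assoc, e1, e2, e3]
  ring

/-- The blocks `PAP` and `QAQ` acquire the factor `a² + b² = 1` and cancel. The blocks `PAQ` and
`QAP` acquire `2ab`, and their sum is `PA + AP - 2PAP`. -/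
theorem weakMeas_defect {P Q A : Matrix d d ℂ} (hPQ : P + Q = 1) {a b : ℝ}
    (hab : a * a + b * b = 1) :
    A - ((a • P + b • Q) * A * (a • P + b • Q) + (b • P + a • Q) * A * (b • P + a • Q)) =
      (1 - 2 * (a * b)) • (P * A + A * P - (2 : ℝ) • (P * A * P)) := by
  obtain rfl : Q = 1 - P := by rw [← hPQ, add_sub_cancel_left]
  have hb : b * b = 1 - a * a := by linarith
  simp only [mul_add, add_mul, mul_sub, sub_mul, smul_mul_assoc, mul_smul_comm, smul_smul, smul_add,
    smul_sub, mul_one, one_mul, mul_comm b a, hb, mul_assoc]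
  module

/-- The coherence is thus a nonnegative multiple, independent of `ρ`, of the skew information of the
single projector `P ⊗ 1`. -/
theorem weakCoherence_eq {P Q : Matrix m m ℂ} (hP : IsStarProjection P) (hPQ : P + Q = 1) (x : ℝ)
    {ρ : Matrix (m × n) (m × n) ℂ} (hρ : ρ.PosSemidef) :
    weakCoherence P Q x ρ =
      2 * (1 - 2 * (Real.sqrt ((1 - Real.tanh x) / 2) * Real.sqrt ((1 + Real.tanh x) / 2))) ^ 2 *
        ((ρ * (P ⊗ₖ 1)).trace.re -
          (CFC.sqrt ρ * (P ⊗ₖ 1) * CFC.sqrt ρ * (P ⊗ₖ 1)).trace.re) := by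
  have hS : CFC.sqrt ρ * CFC.sqrt ρ = ρ := CFC.sqrt_mul_sqrt_self _ hρ.nonneg
  have hSh : (CFC.sqrt ρ).conjTranspose = CFC.sqrt ρ :=
    (Matrix.nonneg_iff_posSemidef.1 (CFC.sqrt_nonneg ρ)).1
  have hab : Real.sqrt ((1 - Real.tanh x) / 2) * Real.sqrt ((1 - Real.tanh x) / 2) +
      Real.sqrt ((1 + Real.tanh x) / 2) * Real.sqrt ((1 + Real.tanh x) / 2) = 1 := by
    rw [Real.mul_self_sqrt (by linarith [Real.tanh_lt_one x]),
      Real.mul_self_sqrt (by linarith [Real.neg_one_lt_tanh x])]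
    ring
  have hPh : (P ⊗ₖ (1 : Matrix n n ℂ)).conjTranspose = P ⊗ₖ 1 :=
    kronecker_one_isHermitian (n := n) hP.isSelfAdjoint
  have hPP : (P ⊗ₖ (1 : Matrix n n ℂ)) * (P ⊗ₖ 1) = P ⊗ₖ 1 := by
    rw [← Matrix.mul_kronecker_mul, hP.isIdempotentElem, one_mul]
  have hPQ' : P ⊗ₖ (1 : Matrix n n ℂ) + Q ⊗ₖ 1 = 1 := by
    rw [← Matrix.add_kronecker, hPQ, Matrix.one_kronecker_one]
  rw [weakCoherence, weakMeas, weakOp_neg, weakOp]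
  simp only [Matrix.add_kronecker, Matrix.smul_kronecker]
  rw [weakMeas_defect hPQ' hab, hsNorm_sq]
  generalize CFC.sqrt ρ = S at *
  generalize P ⊗ₖ (1 : Matrix n n ℂ) = p at *
  generalize 1 - 2 * (Real.sqrt ((1 - Real.tanh x) / 2) * Real.sqrt ((1 + Real.tanh x) / 2)) = c
  have hPP' : ∀ X, p * (p * X) = p * X := fun X => by rw [← mul_assoc, hPP]
  have e1 : (p * (S * (S * p))).trace = (S * (S * p)).trace := by
    rw [Matrix.trace_mul_comm]; simp only [mul_assoc, hPP]
  have e2 : (S * (p * S)).trace = (S * (S * p)).trace := by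
    rw [← mul_assoc, Matrix.trace_mul_comm]
  have e3 : (p * (S * (p * S))).trace = (S * (p * (S * p))).trace := by
    rw [Matrix.trace_mul_comm]; simp only [mul_assoc]
  have e4 : (p * (S * (p * (S * p)))).trace = (S * (p * (S * p))).trace := by
    rw [Matrix.trace_mul_comm]; simp only [mul_assoc, hPP]
  simp only [← hS, Matrix.conjTranspose_smul, Matrix.conjTranspose_sub, Matrix.conjTranspose_add,
    Matrix.conjTranspose_mul, hPh, hSh, star_trivial, mul_add, add_mul, mul_sub, sub_mul,
    smul_mul_assoc, mul_smul_comm, Matrix.trace_add, Matrix.trace_sub, Matrix.trace_smul,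
    Complex.add_re, Complex.sub_re, Complex.smul_re, smul_eq_mul, mul_assoc, hPP', e1, e2, e3,
    e4, smul_sub, smul_add]
  ring

theorem re_trace_sum_smul_mul [Fintype ι] (p : ι → ℝ) (ρ : ι → Matrix d d ℂ) (K : Matrix d d ℂ) :
    ((∑ i, p i • ρ i) * K).trace.re = ∑ i, p i * (ρ i * K).trace.re := by
  simp [Finset.sum_mul, Matrix.trace_sum]

/-- Convexity of the skew information in the state. -/
theorem skewInfo_sum_le [Fintype ι] {p : ι → ℝ} (hp : ∀ i, 0 ≤ p i)
    {ρ : ι → Matrix d d ℂ} (hρ : ∀ i, (ρ i).PosSemidef) {K : Matrix d d ℂ} (hK : K.IsHermitian) :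
    skewInfo (∑ i, p i • ρ i) K ≤ ∑ i, p i * skewInfo (ρ i) K := by
  have hsum : (∑ i, p i • ρ i).PosSemidef :=
    Matrix.posSemidef_sum _ fun i _ => (hρ i).smul (hp i)
  simp only [skewInfo_eq hsum, skewInfo_eq (hρ _), mul_sub, Finset.sum_sub_distrib,
    re_trace_sum_smul_mul]
  linarith [Matrix.sum_re_trace_sqrt_le hp hρ hK]

end WeakMeasurement

theorem mainTheorem5 {m n ι : Type*} [Fintype m] [DecidableEq m] [Fintype n] [DecidableEq n]
    [Fintype ι] (P Q : Matrix m m ℂ) (hP : IsStarProjection P) (hQ : IsStarProjection Q)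
    (hPQ : P + Q = 1) (x : ℝ) (p : ι → ℝ) (hp : ∀ i, 0 ≤ p i) (hp1 : ∑ i, p i = 1)
    (ρ : ι → Matrix (m × n) (m × n) ℂ) (hρ : ∀ i, IsDensityMatrix (ρ i)) :
    weakCoherence P Q x (∑ i, p i • ρ i) ≤ ∑ i, p i * weakCoherence P Q x (ρ i) ∧
      weakSkewInfo P Q x (∑ i, p i • ρ i) ≤ ∑ i, p i * weakSkewInfo P Q x (ρ i) ∧
      ∑ i, p i * weakAffinity P Q x (ρ i) ≤ weakAffinity P Q x (∑ i, p i • ρ i) := by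
  have hpos : ∀ i, (ρ i).PosSemidef := fun i => (hρ i).1
  have hsum : (∑ i, p i • ρ i).PosSemidef :=
    Matrix.posSemidef_sum _ fun i _ => (hpos i).smul (hp i)
  have hK : ∀ y, (weakOp P Q y ⊗ₖ (1 : Matrix n n ℂ)).IsHermitian := fun y =>
    kronecker_one_isHermitian (weakOp_isHermitian hP.isSelfAdjoint hQ.isSelfAdjoint y)
  refine ⟨?_, ?_, ?_⟩
  · simp only [weakCoherence_eq hP hPQ x hsum, weakCoherence_eq hP hPQ x (hpos _)]
    simp only [mul_left_comm (p _), ← Finset.mul_sum]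
    refine mul_le_mul_of_nonneg_left ?_ (by positivity)
    simp only [mul_sub, Finset.sum_sub_distrib, re_trace_sum_smul_mul]
    linarith [Matrix.sum_re_trace_sqrt_le hp hpos
      (kronecker_one_isHermitian (n := n) (A := P) hP.isSelfAdjoint)]
  · simp only [weakSkewInfo, mul_add, Finset.sum_add_distrib]
    exact add_le_add (skewInfo_sum_le hp hpos (hK x)) (skewInfo_sum_le hp hpos (hK (-x)))
  · simp only [weakAffinity_eq, mul_add, Finset.sum_add_distrib]
    exact add_le_add (Matrix.sum_re_trace_sqrt_le hp hpos (hK x))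
      (Matrix.sum_re_trace_sqrt_le hp hpos (hK (-x)))
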